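/- For a set $A$ of nonnegative rational numbers let $\langle A\rangle$ be the additive submonoid of $\mathbb{Q}_{\ge 0}$ generated by $A$, and let $S(A)=\langle A\rangle\cap\mathbb{Z}_{\ge 0}$. Let $a,d,k$ be positive integers with $\gcd(a,d)=1$ and $2\le k\le a$, let $b=a+(k-1)d$ and $\lambda=\left\lfloor\frac{a-2}{k-1}\right\rfloor$, and write $d\,d_a=1+q_a a$ with integers $1\le d_a<a$ and $0\le q_a<d$. Let $S(AP(a,d;k))=\langle a,a+d,\ldots,a+(k-1)d\rangle$ be the submonoid of $\mathbb{Z}_{\ge 0}$ generated by the arithmetic progression. Let $\alpha,\beta\in[1,\infty)\cap\mathbb{Q}$. Fractions with positive numerator and denominator $0$ are read as $\infty$. Consider the conditions (1) $\displaystyle \frac{\lambda a+d(a-1)}{\lambda d_a+q_a(a-1)+1}<\alpha\le\frac{a}{d_a}$ and $\displaystyle \frac{b}{d_a+(k-1)q_a}\le\beta<\frac{\lambda b+d}{\lambda\big(d_a+(k-1)q_a\big)+q_a}$; (2) $\displaystyle \frac{\lambda b+d}{\lambda\big(b-d_a-(k-1)q_a\big)+(d-q_a)}<\alpha\le\frac{b}{b-d_a-(k-1)q_a}$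 and $\displaystyle \frac{a}{a-d_a}\le\beta<\frac{\lambda a+d(a-1)}{\lambda(a-d_a)+(d-q_a)(a-1)-1}$; (3) $\displaystyle \frac{d(a-1)}{q_a(a-1)+1}<\alpha\le\frac{b}{(a-1)q_a+d_a+1}$ and $\displaystyle \frac{b-d}{(a-2)q_a+d_a}\le\beta<\frac{d}{q_a}$; (4) $\displaystyle \frac{d}{d-q_a}<\alpha\le\frac{b-d}{b-d-(a-2)q_a-d_a}$ and $\displaystyle \frac{b}{b-(a-1)q_a-d_a-1}\le\beta<\frac{d(a-1)}{(d-q_a)(a-1)-1}$. If $k<a$, then $S([\alpha,\beta])=S(AP(a,d;k))$ if and only if (1) or (2) holds. If $k=a$, then $S([\alpha,\beta])=S(AP(a,d;k))$ if and only if at least one of (1), (2), (3), (4) holds. -/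

import Mathlib

/-- `S(A) = ⟨A⟩ ∩ ℤ_{≥0}`: the submonoid of the nonnegative integers that lie in the additive
submonoid `⟨A⟩` of the rational numbers generated by `A`. -/
def assocSemigroup (A : Set ℚ) : AddSubmonoid ℕ :=
  (AddSubmonoid.closure A).comap (Nat.castAddMonoidHom ℚ)

/-- The submonoid `⟨a, a + d, …, a + (k - 1) d⟩` of the nonnegative integers. -/
def apSemigroup (a d k : ℕ) : AddSubmonoid ℕ :=
  AddSubmonoid.closure {x : ℕ | ∃ i : ℕ, i < k ∧ x = a + i * d}

/-- `x < p / q`, for `p > 0` and `q ≥ 0`, with the convention `p / 0 = ∞`. -/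
def LtFrac (x p q : ℚ) : Prop :=
  q = 0 ∨ x < p / q

/-! A sum of `m` elements of `[α, β]` fills `[mα, mβ]`, so `S([α, β])` is the projection to `n` of
the lattice points `(n, m)` in the cone of slopes between `x = 1/β` and `y = 1/α`. The map `m ↦ n -
m` reflects the cone without changing the projection; it pairs (1) with (2) and (3) with (4).

If the projection is the progression semigroup, points of the cone over `a` and `a + d` have
determinant `±1` (`exists_det_eq_one_or_neg_one`), so up to reflection `(a, da)` lies in the cone.
In the lattice basis `(a, da)`, `(d, qa)` a point `(s, t)` lies over `s * a + t * d`, and the points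
over one `n` differ by multiples of `(d, -a)`.

What remains is linear: each generator needs a point in the cone, and two critical gaps, `lam * a +
(a - 1) * d` for the upper edge and `lam * b + d` for the lower, must have theirs outside. These
conditions also suffice. Only for `k = a` can the last generator be reached through another point,
`(1 + d, -1)` instead of `(1, a - 1)`; this gives (3) and (4). -/

/-! ### Slope sets and semigroups of intervals -/

/-- The natural numbers `n` for which some integer `m` satisfies `x * n ≤ m ≤ y * n`. -/
def slopeSet (x y : ℚ) : Set ℕ :=
  {n | ∃ m : ℤ, x * n ≤ m ∧ (m : ℚ) ≤ y * n}

theorem mem_slopeSet_of_int {x y : ℚ} {n : ℕ} {N : ℤ} (hN : (n : ℤ) = N) (m : ℤ)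
    (h1 : x * N ≤ m) (h2 : (m : ℚ) ≤ y * N) : n ∈ slopeSet x y := by
  have h : ((n : ℤ) : ℚ) = (N : ℚ) := by rw [hN]
  have h' : (n : ℚ) = (N : ℚ) := by rw [← h]; simp
  exact ⟨m, by rw [h']; exact h1, by rw [h']; exact h2⟩

theorem slopeSet_add {x y : ℚ} {n n' : ℕ} (h : n ∈ slopeSet x y) (h' : n' ∈ slopeSet x y) :
    n + n' ∈ slopeSet x y := by
  obtain ⟨m, h1, h2⟩ := h
  obtain ⟨m', h1', h2'⟩ := h'
  refine ⟨m + m', ?_, ?_⟩ <;> push_cast <;> linarith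

/-- The witness `m` is replaced by `n - m`. -/
theorem slopeSet_reflect_subset (x y : ℚ) : slopeSet x y ⊆ slopeSet (1 - y) (1 - x) := by
  rintro n ⟨m, h1, h2⟩
  refine ⟨n - m, ?_, ?_⟩ <;> push_cast <;> linarith

theorem slopeSet_reflect (x y : ℚ) : slopeSet (1 - y) (1 - x) = slopeSet x y := by
  refine Set.Subset.antisymm ?_ (slopeSet_reflect_subset x y)
  simpa using slopeSet_reflect_subset (1 - y) (1 - x)

theorem mem_assocSemigroup_Icc {α β : ℚ} {n : ℕ} :
    n ∈ assocSemigroup (Set.Icc α β) ↔ ∃ m : ℕ, m * α ≤ n ∧ (n : ℚ) ≤ m * β := by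
  have key : ∀ q ∈ AddSubmonoid.closure (Set.Icc α β), ∃ m : ℕ, m * α ≤ q ∧ q ≤ m * β := by
    intro q hq
    induction hq using AddSubmonoid.closure_induction with
    | mem q hq => exact ⟨1, by simpa using hq.1, by simpa using hq.2⟩
    | zero => exact ⟨0, by simp, by simp⟩
    | add p q _ _ hp hq =>
      obtain ⟨m, h1, h2⟩ := hp
      obtain ⟨m', h1', h2'⟩ := hq
      refine ⟨m + m', ?_, ?_⟩ <;> push_cast <;> linarith
  constructor
  · intro h
    exact key _ h
  · rintro ⟨m, h1, h2⟩
    change (n : ℚ) ∈ AddSubmonoid.closure (Set.Icc α β)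
    rcases Nat.eq_zero_or_pos m with rfl | hm
    · have : (n : ℚ) = 0 := le_antisymm (by simpa using h2) (by positivity)
      rw [this]
      exact zero_mem _
    · have hm' : (0 : ℚ) < m := by exact_mod_cast hm
      have hmem : (n : ℚ) / m ∈ Set.Icc α β := by
        constructor
        · rw [le_div_iff₀ hm']; linarith
        · rw [div_le_iff₀ hm']; linarith
      have := nsmul_mem (AddSubmonoid.subset_closure hmem) m
      rwa [nsmul_eq_mul, mul_div_cancel₀ _ hm'.ne'] at this

theorem assocSemigroup_Icc_eq_slopeSet {α β : ℚ} (hα : 1 ≤ α) (hβ : 1 ≤ β) :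
    (assocSemigroup (Set.Icc α β) : Set ℕ) = slopeSet β⁻¹ α⁻¹ := by
  have hα0 : 0 < α := by linarith
  have hβ0 : 0 < β := by linarith
  have hx : ∀ n m : ℚ, β⁻¹ * n ≤ m ↔ n ≤ m * β := fun n m => by
    rw [inv_mul_le_iff₀ hβ0, mul_comm]
  have hy : ∀ n m : ℚ, m ≤ α⁻¹ * n ↔ m * α ≤ n := fun n m => by
    rw [le_inv_mul_iff₀ hα0, mul_comm]
  ext n
  rw [SetLike.mem_coe, mem_assocSemigroup_Icc]
  constructor
  · rintro ⟨m, h1, h2⟩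
    exact ⟨m, by rw [hx]; simpa using h2, by rw [hy]; simpa using h1⟩
  · rintro ⟨m, h1, h2⟩
    have hm : 0 ≤ m := by
      have : (0 : ℚ) ≤ m := le_trans (by positivity) h1
      exact_mod_cast this
    lift m to ℕ using hm
    exact ⟨m, by rw [hy] at h2; simpa using h2, by rw [hx] at h1; simpa using h1⟩

/-! ### Membership in the semigroup of the progression -/

theorem mem_apSemigroup {a d k n : ℕ} (hk : 2 ≤ k) :
    n ∈ apSemigroup a d k ↔ ∃ s t : ℕ, t ≤ (k - 1) * s ∧ n = s * a + t * d := by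
  constructor
  · intro h
    induction h using AddSubmonoid.closure_induction with
    | mem q hq =>
      obtain ⟨i, hi, rfl⟩ := hq
      exact ⟨1, i, by omega, by ring⟩
    | zero => exact ⟨0, 0, by simp, by simp⟩
    | add p q _ _ hp hq =>
      obtain ⟨s, t, h1, rfl⟩ := hp
      obtain ⟨s', t', h1', rfl⟩ := hq
      exact ⟨s + s', t + t', by rw [mul_add]; omega, by ring⟩
  · rintro ⟨s, t, h, rfl⟩
    induction s generalizing t with
    | zero =>
      obtain rfl : t = 0 := by simpa using h
      simp
    | succ s ih =>
      -- Greedy choice: one generator absorbs as much of `t` as it can, at most `k - 1`.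
      have hs : t - min t (k - 1) ≤ (k - 1) * s := by rw [mul_add] at h; omega
      have hg : a + min t (k - 1) * d ∈ apSemigroup a d k :=
        AddSubmonoid.subset_closure ⟨min t (k - 1), by omega, rfl⟩
      have := add_mem (ih _ hs) hg
      convert this using 1
      have ht : t = (t - min t (k - 1)) + min t (k - 1) := by omega
      generalize t - min t (k - 1) = u at ht
      generalize min t (k - 1) = v at ht
      subst ht
      ring

theorem mem_apSemigroup_int {a d k n : ℕ} (hk : 2 ≤ k) :
    n ∈ apSemigroup a d k ↔
      ∃ s t : ℤ, 0 ≤ t ∧ t ≤ ((k : ℤ) - 1) * s ∧ (n : ℤ) = s * a + t * d := by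
  have hk1 : ((k - 1 : ℕ) : ℤ) = (k : ℤ) - 1 := by push_cast [show 1 ≤ k by omega]; ring
  rw [mem_apSemigroup hk]
  constructor
  · rintro ⟨s, t, h, rfl⟩
    refine ⟨s, t, by positivity, ?_, by push_cast; ring⟩
    rw [← hk1]
    exact_mod_cast h
  · rintro ⟨s, t, ht, h, hn⟩
    have hs : 0 ≤ s := by
      by_contra hs
      have : (1 : ℤ) ≤ (k : ℤ) - 1 := by omega
      nlinarith
    lift s to ℕ using hs
    lift t to ℕ using ht
    rw [← hk1] at h
    exact ⟨s, t, by exact_mod_cast h, by exact_mod_cast hn⟩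

/-- The representation `n = s * a + t * d` with `0 ≤ t < a` decides membership. -/
theorem le_of_mem_apSemigroup {a d k n : ℕ} (hk : 2 ≤ k) (hgcd : Nat.gcd a d = 1) {s t : ℤ}
    (ha : 0 < a) (hta : t < a) (hn : (n : ℤ) = s * a + t * d)
    (h : n ∈ apSemigroup a d k) : t ≤ ((k : ℤ) - 1) * s := by
  obtain ⟨s', t', ht', h', hn'⟩ := (mem_apSemigroup_int hk).1 h
  have hcop : IsCoprime (a : ℤ) d := Nat.isCoprime_iff_coprime.2 hgcd
  have hdvd : (a : ℤ) ∣ t' - t := by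
    refine hcop.dvd_of_dvd_mul_right ⟨s - s', ?_⟩
    linarith
  obtain ⟨j, hj⟩ := hdvd
  have ha' : (0 : ℤ) < a := by exact_mod_cast ha
  -- Here `t' = t + a * j`; since `t < a` and `t' ≥ 0`, `j` cannot be negative. Trading `j * a`
  -- copies of `d` for `j * d` copies of `a` then only relaxes the bound.
  have hj0 : 0 ≤ j := by
    by_contra hj0
    have : j ≤ -1 := by omega
    nlinarith
  have hs : s = s' + j * d := by
    have : (a : ℤ) * (s - (s' + j * d)) = 0 := by
      have : t' = t + a * j := by linarith
      subst this
      linarith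
    rcases mul_eq_zero.1 this with h0 | h0 <;> omega
  have hk1 : (0 : ℤ) ≤ (k : ℤ) - 1 := by omega
  have h1 : 0 ≤ (a : ℤ) * j := by positivity
  have h2 : 0 ≤ ((k : ℤ) - 1) * (j * d) := by positivity
  rw [hs, mul_add]
  linarith

theorem pos_le_of_mem_apSemigroup {a d k n : ℕ} (hk : 2 ≤ k) (hn : 0 < n)
    (h : n ∈ apSemigroup a d k) : a ≤ n := by
  obtain ⟨s, t, hts, rfl⟩ := (mem_apSemigroup hk).1 h
  rcases Nat.eq_zero_or_pos s with rfl | hs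
  · obtain rfl : t = 0 := by simpa using hts
    simp at hn
  · nlinarith [Nat.zero_le (t * d)]

/-- Reducing `t` modulo `a` turns the coefficient of `a` into `s + d * (t / a)`. Once this exceeds
`lam`, it allows every remainder up to `a - 1`. -/
theorem mem_apSemigroup_of_large {a d k n : ℕ} (hk : 2 ≤ k) (ha : 0 < a) {lam s t : ℤ}
    (hlam : (a : ℤ) - 1 ≤ ((k : ℤ) - 1) * (lam + 1)) (hn : (n : ℤ) = s * a + t * d)
    (h : lam + 1 ≤ s + d * (t / a)) : n ∈ apSemigroup a d k := by
  have ha' : (0 : ℤ) < a := by exact_mod_cast ha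
  have h1 := Int.emod_nonneg t ha'.ne'
  have h2 := Int.emod_lt_of_pos t ha'
  have h3 := Int.emod_add_mul_ediv t a
  refine (mem_apSemigroup_int hk).2 ⟨s + d * (t / a), t % a, h1, ?_, ?_⟩
  · have hk1 : (0 : ℤ) ≤ (k : ℤ) - 1 := by omega
    nlinarith [mul_le_mul_of_nonneg_left h hk1]
  · rw [hn]
    nth_rewrite 1 [← h3]
    ring

/-! ### Admissible cones and the determinant -/

/-- The slope intervals `[x, y]` around the slopes `da / a > (da + qa) / (a + d) > …` that give the
semigroup of the progression. -/
def SlopeRange (a d k lam da qa : ℕ) (x y : ℚ) : Prop :=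
  y * (lam * a + d * ((a : ℚ) - 1)) < lam * da + qa * ((a : ℚ) - 1) + 1 ∧
  lam * (da + ((k : ℚ) - 1) * qa) + qa < x * (lam * (a + ((k : ℚ) - 1) * d) + d) ∧
  (((da : ℚ) ≤ y * a ∧ x * (a + ((k : ℚ) - 1) * d) ≤ da + ((k : ℚ) - 1) * qa) ∨
    (k = a ∧ ((a : ℚ) - 1) * qa + da + 1 ≤ y * (a + ((a : ℚ) - 1) * d) ∧
      x * (a + ((a : ℚ) - 2) * d) ≤ ((a : ℚ) - 2) * qa + da))

/-- Points over `a` and `a + d` of a cone giving the semigroup span the lattice. -/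
theorem exists_det_eq_one_or_neg_one {a d k : ℕ} (hd : 0 < d) (hgcd : Nat.gcd a d = 1)
    (hk : 2 ≤ k) (hka : k ≤ a) {x y : ℚ} (h : slopeSet x y = apSemigroup a d k) :
    ∃ p p' : ℤ, (x * a ≤ p ∧ p ≤ y * a) ∧
      (p * d - (p' - p) * a = 1 ∨ p * d - (p' - p) * a = -1) := by
  have hmem : ∀ n, n ∈ slopeSet x y ↔ n ∈ apSemigroup a d k := fun n => by rw [h]; rfl
  have ha : (0 : ℤ) < a := by omega
  have haq : (0 : ℚ) < a := by exact_mod_cast ha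
  obtain ⟨p, hp1, hp2⟩ : a ∈ slopeSet x y :=
    (hmem _).2 ((mem_apSemigroup hk).2 ⟨1, 0, by omega, by ring⟩)
  obtain ⟨p', hp1', hp2'⟩ : a + d ∈ slopeSet x y :=
    (hmem _).2 ((mem_apSemigroup hk).2 ⟨1, 1, by omega, by ring⟩)
  push_cast at hp1' hp2'
  refine ⟨p, p', ⟨hp1, hp2⟩, ?_⟩
  have hcop : IsCoprime (a : ℤ) d := Nat.isCoprime_iff_coprime.2 hgcd
  -- A common factor could be divided out of `(a, p)`, giving a positive element of the semigroup
  -- below its minimum `a`.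
  have hap : IsCoprime p (a : ℤ) := by
    rw [Int.isCoprime_iff_gcd_eq_one]
    have hg0 : 0 < Int.gcd p a := Int.gcd_pos_of_ne_zero_right _ ha.ne'
    obtain ⟨c, hc⟩ : Int.gcd p a ∣ a := by
      have := Int.gcd_dvd_right p (a : ℤ)
      exact_mod_cast this
    obtain ⟨q, hq⟩ := Int.gcd_dvd_left p (a : ℤ)
    generalize Int.gcd p a = g at *
    have hgq : (0 : ℚ) < g := by exact_mod_cast hg0
    have hcq : (a : ℚ) = g * c := by exact_mod_cast hc
    have hqq : (p : ℚ) = g * q := by exact_mod_cast hq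
    have hc0 : 0 < c := by
      rcases Nat.eq_zero_or_pos c with rfl | h0
      · omega
      · exact h0
    have hcS : c ∈ slopeSet x y := by
      refine ⟨q, ?_, ?_⟩
      · refine le_of_mul_le_mul_left ?_ hgq
        rw [← hqq]
        calc (g : ℚ) * (x * c) = x * (g * c) := by ring
          _ ≤ p := by rw [← hcq]; exact hp1
      · refine le_of_mul_le_mul_left ?_ hgq
        rw [← hqq]
        calc (p : ℚ) ≤ y * (g * c) := by rw [← hcq]; exact hp2
          _ = g * (y * c) := by ring
    have hle := pos_le_of_mem_apSemigroup hk hc0 ((hmem _).1 hcS)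
    by_contra hg1
    have : 2 ≤ g := by omega
    nlinarith
  obtain ⟨c, q, hcq⟩ := hap
  set δ := p * d - (p' - p) * a with hδ
  have hδ0 : δ ≠ 0 := by
    intro h0
    have hdvd : (a : ℤ) ∣ p := hcop.dvd_of_dvd_mul_right ⟨p' - p, by linarith⟩
    have h1 : (a : ℤ) ∣ 1 := by
      rw [← hcq]
      exact dvd_add (hdvd.mul_left _) (dvd_mul_left _ _)
    have := Int.le_of_dvd one_pos h1
    omega
  by_contra hcon
  have hδ2 : 2 ≤ |δ| := by
    rcases abs_cases δ with ⟨h1, h2⟩ | ⟨h1, h2⟩ <;> omega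
  -- Since `(a, p)` is primitive, `(a + d, p')` is congruent to `u * (a, p)` modulo `δ`. With `e`
  -- the residue of `-u`, the vector `(a + d, p') + e * (a, p)` is divisible by `|δ|`, and the
  -- quotient `(N, M)` lies in the cone.
  set u := p' * c + q * (a + d) with hu
  have he0 := Int.emod_nonneg (-u) hδ0
  have he1 := Int.emod_lt_abs (-u) hδ0
  have he := Int.emod_add_mul_ediv (-u) δ
  set e := (-u) % δ with hedef
  have hua : (a : ℤ) + d - u * a = δ * c := by
    rw [hu, hδ]; linear_combination (-(a : ℤ) - d) * hcq
  have hup : p' - u * p = - δ * q := by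
    rw [hu, hδ]; linear_combination (-p') * hcq
  have hdn : |δ| ∣ (a : ℤ) + d + e * a := by
    rw [abs_dvd]
    exact ⟨c - (-u / δ) * a, by linear_combination hua + (a : ℤ) * he⟩
  have hdm : |δ| ∣ p' + e * p := by
    rw [abs_dvd]
    exact ⟨-q - (-u / δ) * p, by linear_combination hup + p * he⟩
  obtain ⟨N, hN⟩ := hdn
  obtain ⟨M, hM⟩ := hdm
  generalize |δ| = D at *
  have hDq : (0 : ℚ) < D := by exact_mod_cast (by omega : 0 < D)
  have hNpos : 0 < N := by
    have : 0 < D * N := by rw [← hN]; positivity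
    exact (mul_pos_iff_of_pos_left (by omega)).1 this
  have hNq : (D : ℚ) * N = a + d + e * a := by exact_mod_cast hN.symm
  have hMq : (D : ℚ) * M = p' + e * p := by exact_mod_cast hM.symm
  have heq : (0 : ℚ) ≤ e := by exact_mod_cast he0
  lift N to ℕ using hNpos.le
  have hNS : N ∈ slopeSet x y := by
    refine mem_slopeSet_of_int rfl M ?_ ?_
    · refine le_of_mul_le_mul_left ?_ hDq
      have := mul_le_mul_of_nonneg_left hp1 heq
      calc (D : ℚ) * (x * _) = x * (D * ((N : ℤ) : ℚ)) := by ring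
        _ ≤ D * M := by rw [hNq, hMq]; linarith
    · refine le_of_mul_le_mul_left ?_ hDq
      have := mul_le_mul_of_nonneg_left hp2 heq
      calc (D : ℚ) * M ≤ y * (D * ((N : ℤ) : ℚ)) := by rw [hNq, hMq]; linarith
        _ = _ := by ring
  obtain ⟨s, t, ht0, hts, hst⟩ := (mem_apSemigroup_int hk).1 ((hmem _).1 hNS)
  have hs : 1 ≤ s := by
    by_contra hs
    have h1 : ((k : ℤ) - 1) * s ≤ 0 :=
      mul_nonpos_of_nonneg_of_nonpos (by omega) (by omega)
    have h2 : s * a ≤ 0 := mul_nonpos_of_nonpos_of_nonneg (by omega) ha.le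
    have h3 : t = 0 := by omega
    rw [h3] at hst
    omega
  rw [hst] at hN
  have hd' : (0 : ℤ) < d := by exact_mod_cast hd
  -- If `t = 0`, then `a ∣ d`, against coprimality. If `t ≥ 1`, then `N ≥ a + d`, too large because
  -- `e + 1 ≤ D` and `D ≥ 2`.
  rcases ht0.eq_or_lt with rfl | ht
  · have hdvd : (a : ℤ) ∣ d := ⟨D * s - 1 - e, by linear_combination hN⟩
    have : (a : ℤ) ∣ 1 := by
      have := Int.dvd_coe_gcd (dvd_refl (a : ℤ)) hdvd
      simpa [hgcd] using this
    have := Int.le_of_dvd one_pos this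
    omega
  · have h1 : D * a ≤ D * (s * a) := mul_le_mul_of_nonneg_left (by nlinarith) (by omega)
    have h2 : D * d ≤ D * (t * d) := mul_le_mul_of_nonneg_left (by nlinarith) (by omega)
    have h3 : (e + 1) * a ≤ D * a := mul_le_mul_of_nonneg_right (by omega) ha.le
    nlinarith

/-! ### Linear conditions in the basis `(a, da)`, `(d, qa)` -/

section Core

variable {a d k lam da qa : ℕ}

/-- A point over `a + i * d` of the cone is the standard one, unless `k = a` and `i = a - 1`. -/
theorem offset_eq_zero_or_one (ha : 2 ≤ a) (hd : 0 < d) (hka : k ≤ a) {i : ℕ} (hi : i < k)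
    {u0 u1 l0 l1 : ℚ} (hu0 : 0 ≤ u0) (hl0 : 0 ≤ l0) (hF : (lam + d) * u0 - u1 < 0) (hl1 : l1 < 0)
    {j : ℤ} (hU : 0 ≤ (1 + j * d) * u0 + (i - j * a) * u1)
    (hL : 0 ≤ (1 + j * d) * l0 + (i - j * a) * l1) :
    j = 0 ∨ (j = 1 ∧ k = a ∧ i = a - 1 ∧ lam = 0) := by
  have hdz : (1 : ℤ) ≤ d := by exact_mod_cast hd
  have haz : (2 : ℤ) ≤ a := by exact_mod_cast ha
  have hi' : (i : ℤ) ≤ a - 1 := by omega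
  have hi0 : (0 : ℤ) ≤ i := by positivity
  rcases lt_trichotomy j 0 with hj0 | rfl | hj0
  · exfalso
    have h1 : 1 + j * d ≤ 0 := by nlinarith
    have h2 : 0 < i - j * a := by nlinarith
    have h1q : (1 + j * d : ℚ) ≤ 0 := by exact_mod_cast h1
    have h2q : (0 : ℚ) < i - j * a := by exact_mod_cast h2
    have h3 := mul_nonpos_of_nonpos_of_nonneg h1q hl0
    have h4 := mul_neg_of_pos_of_neg h2q hl1
    linarith
  · exact Or.inl rfl
  · right
    -- The upper edge forces `(j * a - i) * (lam + d) < 1 + j * d`. As `j * a - i ≥ j`, this leaves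
    -- only `lam = 0` and `j * a - i = j`, hence `j = 1` and `i = a - 1`.
    have hge : j ≤ j * a - i := by nlinarith
    have hgeq : (0 : ℚ) < j * a - i := by exact_mod_cast (by omega : 0 < j * a - i)
    have h1 : (j * a - i) * ((lam + d) * u0) < (j * a - i) * u1 :=
      mul_lt_mul_of_pos_left (by linarith) hgeq
    have h2 : u0 * ((j * a - i) * (lam + d)) < u0 * (1 + j * d) := by linarith
    have h3 := lt_of_mul_lt_mul_left h2 hu0
    have h4 : (j * a - i) * (lam + d) < 1 + j * d := by exact_mod_cast h3
    have h5 : j * (lam + d) ≤ (j * a - i) * (lam + d) :=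
      mul_le_mul_of_nonneg_right hge (by positivity)
    have hlam0 : lam = 0 := by
      by_contra hne
      have : (1 : ℤ) ≤ lam := by omega
      nlinarith
    have h6 : j * a - i - j ≤ 0 := by
      by_contra hne
      rw [hlam0] at h4
      push_cast at h4
      nlinarith
    have hj1 : j = 1 := by
      by_contra hne
      have : 2 ≤ j := by omega
      nlinarith
    subst hj1
    exact ⟨rfl, by omega, by omega, hlam0⟩

/-- Necessity: gaps of the semigroup must have all their lattice points outside the cone, while each
generator must have one inside. -/
theorem slopeRange_of_slopeSet_eq (hd : 0 < d) (hgcd : Nat.gcd a d = 1)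
    (hk : 2 ≤ k) (hka : k ≤ a) (hlam : ((k : ℤ) - 1) * lam ≤ a - 2)
    (hda : d * da = 1 + qa * a) {x y : ℚ}
    (hx : x * a ≤ da) (hy : da ≤ y * a) (h : slopeSet x y = apSemigroup a d k) :
    SlopeRange a d k lam da qa x y := by
  have hmem : ∀ n, n ∈ slopeSet x y ↔ n ∈ apSemigroup a d k := fun n => by rw [h]; rfl
  have haq : (2 : ℚ) ≤ a := by exact_mod_cast (by omega : 2 ≤ a)
  have hdq : (0 : ℚ) < d := by exact_mod_cast hd
  have hdaq : (d : ℚ) * da = 1 + qa * a := by exact_mod_cast hda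
  have hlq : (0 : ℚ) ≤ lam := by positivity
  have hkq : (1 : ℚ) ≤ (k : ℚ) - 1 := by
    have : (2 : ℚ) ≤ k := by exact_mod_cast hk
    linarith
  -- The edge forms `y * n - m` and `m - x * n` become `s * u0 + t * u1` and `s * l0 + t * l1` in
  -- the lattice coordinates.
  obtain ⟨u0, hu0⟩ : ∃ u0, u0 = y * a - da := ⟨_, rfl⟩
  obtain ⟨u1, hu1⟩ : ∃ u1, u1 = y * d - qa := ⟨_, rfl⟩
  obtain ⟨l0, hl0⟩ : ∃ l0, l0 = da - x * a := ⟨_, rfl⟩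
  obtain ⟨l1, hl1⟩ : ∃ l1, l1 = qa - x * d := ⟨_, rfl⟩
  have hu : a * u1 - d * u0 = 1 := by rw [hu0, hu1]; linear_combination hdaq
  have hl : a * l1 - d * l0 = -1 := by rw [hl0, hl1]; linear_combination -hdaq
  have hu0n : 0 ≤ u0 := by linarith
  have hl0n : 0 ≤ l0 := by linarith
  have hu1p : 0 < u1 := by
    have : 0 < a * u1 := by nlinarith
    exact (mul_pos_iff_of_pos_left (by linarith)).1 this
  have hpt : ∀ (n : ℕ) (s t : ℤ), (n : ℤ) = s * a + t * d → 0 ≤ s * u0 + t * u1 →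
      0 ≤ s * l0 + t * l1 → n ∈ apSemigroup a d k := by
    intro n s t hn h1 h2
    rw [hu0, hu1] at h1
    rw [hl0, hl1] at h2
    refine (hmem n).1 (mem_slopeSet_of_int hn (s * da + t * qa) ?_ ?_) <;> push_cast <;> linarith
  have hk1z : (1 : ℤ) ≤ (k : ℤ) - 1 := by omega
  have hl1n : l1 < 0 := by
    by_contra hcon
    have hm := hpt d 0 1 (by ring) (by push_cast; linarith) (by push_cast; linarith)
    have := le_of_mem_apSemigroup (s := 0) (t := 1) hk hgcd (by omega) (by omega) (by ring) hm
    omega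
  -- The gap `lam * a + (a - 1) * d`, which is the Frobenius number, equals `(lam + d) * a - d`. Its
  -- point `(lam + d, -1)` satisfies the lower inequality automatically, so it must violate the
  -- upper one.
  have hF : (lam + d) * u0 - u1 < 0 := by
    by_contra hcon
    have hm := hpt (lam * a + (a - 1) * d) (lam + d) (-1)
      (by push_cast [show 1 ≤ a by omega]; ring) (by push_cast; linarith)
      (by push_cast; nlinarith [mul_nonneg hlq hl0n, mul_nonneg hdq.le hl0n])
    have := le_of_mem_apSemigroup (s := lam) (t := a - 1) hk hgcd (by omega) (by omega)
      (by push_cast [show 1 ≤ a by omega]; ring) hm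
    omega
  have hover : ∀ i : ℕ, i < k → (0 ≤ u0 + i * u1 ∧ 0 ≤ l0 + i * l1) ∨
      (k = a ∧ i = a - 1 ∧ 0 ≤ (1 + d) * u0 - u1 ∧ lam = 0) := by
    intro i hi
    obtain ⟨m, hm1, hm2⟩ : a + i * d ∈ slopeSet x y :=
      (hmem _).2 ((mem_apSemigroup hk).2 ⟨1, i, by omega, by ring⟩)
    push_cast at hm1 hm2
    obtain ⟨j, hj⟩ : ∃ j : ℤ, m = (1 + j * d) * da + (i - j * a) * qa := by
      refine ⟨m - da - i * qa, ?_⟩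
      have hdaz : (d : ℤ) * da = 1 + qa * a := by exact_mod_cast hda
      linear_combination (-(m - da - i * qa)) * hdaz
    have hjq : (m : ℚ) = (1 + j * d) * da + (i - j * a) * qa := by exact_mod_cast hj
    have hU : 0 ≤ (1 + j * d) * u0 + (i - j * a) * u1 := by
      rw [hu0, hu1]; linarith
    have hL : 0 ≤ (1 + j * d) * l0 + (i - j * a) * l1 := by
      rw [hl0, hl1]; linarith
    rcases offset_eq_zero_or_one (by omega) hd hka hi hu0n hl0n hF hl1n hU hL with
      rfl | ⟨rfl, hka', hia, hlam0⟩
    · left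
      push_cast at hU hL
      constructor <;> linarith
    · right
      refine ⟨hka', hia, ?_, hlam0⟩
      have hiq : (i : ℚ) = a - 1 := by
        rw [hia]; push_cast [show 1 ≤ a by omega]; ring
      rw [hiq] at hU
      push_cast at hU
      linarith
  have hFgoal : y * (lam * a + d * ((a : ℚ) - 1)) < lam * da + qa * ((a : ℚ) - 1) + 1 := by
    rw [hu0, hu1] at hF
    linarith
  have hkc : ((k - 1 : ℕ) : ℚ) = (k : ℚ) - 1 := by push_cast [show 1 ≤ k by omega]; ring
  rcases hover (k - 1) (by omega) with ⟨hU, hL⟩ | ⟨hka', -, hU, hlam0⟩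
  · rw [hkc] at hU hL
    refine ⟨hFgoal, ?_, Or.inl ⟨hy, by rw [hl0, hl1] at hL; linarith⟩⟩
    -- Here `t = lam * (k - 1) + 1` is one more than `s = lam` allows and still below `a`, so this
    -- is a gap. The upper inequality holds, so the lower one must fail.
    have hG : lam * l0 + (lam * (k - 1) + 1) * l1 < 0 := by
      by_contra hcon
      have hm := hpt (lam * a + (lam * (k - 1) + 1) * d) lam (lam * ((k : ℤ) - 1) + 1)
        (by push_cast [show 1 ≤ k by omega]; ring) (by push_cast; positivity)
        (by push_cast; linarith)
      have := le_of_mem_apSemigroup (s := lam) (t := lam * ((k : ℤ) - 1) + 1) hk hgcd (by omega)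
        (by linarith) (by push_cast [show 1 ≤ k by omega]; ring) hm
      linarith
    rw [hl0, hl1] at hG
    linarith
  · subst hka'
    refine ⟨hFgoal, ?_, Or.inr ⟨rfl, by rw [hu0, hu1] at hU; linarith, ?_⟩⟩
    · rw [hlam0]
      push_cast
      linarith
    -- Only the last generator may use the exceptional point, so the one before it gives the lower
    -- bound.
    · rcases hover (k - 2) (by omega) with ⟨-, hL⟩ | ⟨-, h0, -⟩
      · have hkc2 : ((k - 2 : ℕ) : ℚ) = (k : ℚ) - 2 := by push_cast [hk]; ring
        rw [hkc2, hl0, hl1] at hL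
        linarith
      · omega

/-- Sufficiency: a point of the cone either has `0 ≤ t ≤ (k - 1) * s`, or an edge inequality makes
its reduced coefficient of `a` exceed `lam`. -/
theorem slopeSet_eq_of_slopeRange (hd : 0 < d)
    (hk : 2 ≤ k) (hka : k ≤ a) (hlam : ((k : ℤ) - 1) * lam ≤ a - 2)
    (hlam' : (a : ℤ) - 1 ≤ ((k : ℤ) - 1) * (lam + 1))
    (hda : d * da = 1 + qa * a) {x y : ℚ}
    (h : SlopeRange a d k lam da qa x y) : slopeSet x y = apSemigroup a d k := by
  obtain ⟨hF, hG, hin⟩ := h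
  have haq : (2 : ℚ) ≤ a := by exact_mod_cast (by omega : 2 ≤ a)
  have hdq : (0 : ℚ) < d := by exact_mod_cast hd
  have hdaq : (d : ℚ) * da = 1 + qa * a := by exact_mod_cast hda
  have hlq : (0 : ℚ) ≤ lam := by positivity
  have hkq : (1 : ℚ) ≤ (k : ℚ) - 1 := by
    have : (2 : ℚ) ≤ k := by exact_mod_cast hk
    linarith
  obtain ⟨u0, hu0⟩ : ∃ u0, u0 = y * a - da := ⟨_, rfl⟩
  obtain ⟨u1, hu1⟩ : ∃ u1, u1 = y * d - qa := ⟨_, rfl⟩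
  obtain ⟨l0, hl0⟩ : ∃ l0, l0 = da - x * a := ⟨_, rfl⟩
  obtain ⟨l1, hl1⟩ : ∃ l1, l1 = qa - x * d := ⟨_, rfl⟩
  have hu : a * u1 - d * u0 = 1 := by rw [hu0, hu1]; linear_combination hdaq
  replace hF : (lam + d) * u0 < u1 := by rw [hu0, hu1]; linarith
  replace hG : lam * (l0 + (k - 1) * l1) + l1 < 0 := by rw [hl0, hl1]; linarith
  replace hin : (0 ≤ u0 ∧ 0 ≤ l0 + (k - 1) * l1) ∨
      (k = a ∧ 0 ≤ (1 + d) * u0 - u1 ∧ 0 ≤ l0 + (a - 2) * l1) := by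
    rw [hu0, hu1, hl0, hl1]
    rcases hin with ⟨h1, h2⟩ | ⟨h0, h1, h2⟩
    · left; constructor <;> linarith
    · right; refine ⟨h0, ?_, ?_⟩ <;> linarith
  have hlam0 : k = a → lam = 0 := by
    rintro rfl
    by_contra hne
    have : (1 : ℤ) ≤ lam := by omega
    nlinarith
  have hu0n : 0 ≤ u0 := by
    rcases hin with ⟨h1, -⟩ | ⟨h0, h1, -⟩
    · exact h1
    · rw [hlam0 h0] at hF
      push_cast at hF
      linarith
  have hl1n : l1 < 0 := by
    rcases hin with ⟨-, h1⟩ | ⟨h0, -, -⟩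
    · have := mul_nonneg hlq h1
      linarith
    · rw [hlam0 h0] at hG
      simpa using hG
  have hl0n : 0 ≤ l0 := by
    rcases hin with ⟨-, h1⟩ | ⟨-, -, h1⟩ <;> nlinarith
  have hu1p : 0 < u1 := lt_of_le_of_lt (by positivity) hF
  have hpt : ∀ (n : ℕ) (s t : ℤ), (n : ℤ) = s * a + t * d → 0 ≤ s * u0 + t * u1 →
      0 ≤ s * l0 + t * l1 → n ∈ slopeSet x y := by
    intro n s t hn h1 h2
    rw [hu0, hu1] at h1
    rw [hl0, hl1] at h2
    refine mem_slopeSet_of_int hn (s * da + t * qa) ?_ ?_ <;> push_cast <;> linarith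
  ext n
  constructor
  · rintro ⟨m, hm1, hm2⟩
    have hdaz : (d : ℤ) * da = 1 + qa * a := by exact_mod_cast hda
    obtain ⟨s, t, hn, hm⟩ :
        ∃ s t : ℤ, (n : ℤ) = s * a + t * d ∧ m = s * da + t * qa := by
      refine ⟨m * d - n * qa, n * da - m * a, ?_, ?_⟩
      · linear_combination (-(n : ℤ)) * hdaz
      · linear_combination (-m) * hdaz
    have hnq : (n : ℚ) = s * a + t * d := by exact_mod_cast hn
    have hmq : (m : ℚ) = s * da + t * qa := by exact_mod_cast hm
    rw [hnq, hmq] at hm1 hm2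
    have hU : 0 ≤ s * u0 + t * u1 := by rw [hu0, hu1]; linarith
    have hL : 0 ≤ s * l0 + t * l1 := by rw [hl0, hl1]; linarith
    -- For `t < 0` the upper edge gives `s > -t * (lam + d)`, which outweighs the loss `d * (t / a)
    -- ≥ d * t` from reduction.
    rcases lt_or_ge t 0 with ht | ht
    · refine mem_apSemigroup_of_large hk (by omega) hlam' hn ?_
      have htq : (0 : ℚ) < -t := by exact_mod_cast (by omega : 0 < -t)
      have h1 := mul_lt_mul_of_pos_left hF htq
      have h2 : u0 * (-t * (lam + d)) < u0 * s := by linarith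
      have h3 := lt_of_mul_lt_mul_left h2 hu0n
      have h4 : -t * (lam + d) < s := by exact_mod_cast h3
      have h5 : t ≤ t / a := by
        rw [Int.le_ediv_iff_mul_le (by omega)]
        nlinarith
      have h6 : (d : ℤ) * t ≤ d * (t / a) := mul_le_mul_of_nonneg_left h5 (by positivity)
      have h7 : (lam : ℤ) ≤ -t * lam := by nlinarith
      nlinarith
    · by_cases hts : t ≤ ((k : ℤ) - 1) * s
      · exact (mem_apSemigroup_int hk).2 ⟨s, t, ht, hts, hn⟩
      · refine mem_apSemigroup_of_large hk (by omega) hlam' hn ?_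
        have h0 : 0 ≤ (d : ℤ) * (t / a) := by positivity
        suffices (lam : ℤ) < s by omega
        -- With `w = l0 + (k - 1) * l1`, the lower edge yields `s * w ≥ -l1 > lam * w`. In the
        -- exceptional case `lam = 0`, so only `s > 0` is needed.
        rcases hin with ⟨-, hw⟩ | ⟨h0, -, -⟩
        · have he : (1 : ℚ) ≤ t - (k - 1) * s := by
            exact_mod_cast (by omega : 1 ≤ t - ((k : ℤ) - 1) * s)
          have h1 : (t - (k - 1) * s) * l1 ≤ 1 * l1 := mul_le_mul_of_nonpos_right he hl1n.le
          have h2 : (l0 + (k - 1) * l1) * lam < (l0 + (k - 1) * l1) * s := by linarith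
          have h3 := lt_of_mul_lt_mul_left h2 hw
          exact_mod_cast h3
        · rw [hlam0 h0]
          by_contra hs
          have hs' : s ≤ 0 := by simpa using hs
          have hsq : (s : ℚ) ≤ 0 := by exact_mod_cast hs'
          have htq : (0 : ℚ) ≤ t := by exact_mod_cast ht
          have h1 : (s : ℚ) * l0 ≤ 0 := mul_nonpos_of_nonpos_of_nonneg hsq hl0n
          have h2 : (t : ℚ) * l1 = 0 :=
            le_antisymm (mul_nonpos_of_nonneg_of_nonpos htq hl1n.le) (by linarith)
          have h3 : (t : ℚ) = 0 := (mul_eq_zero.1 h2).resolve_right hl1n.ne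
          have h4 : t = 0 := by exact_mod_cast h3
          subst h4
          rcases hs'.eq_or_lt with rfl | hs0
          · simp at hts
          · have : s * (a : ℤ) < 0 := mul_neg_of_neg_of_pos hs0 (by omega)
            omega
  · intro hn
    induction hn using AddSubmonoid.closure_induction with
    | zero => exact ⟨0, by simp, by simp⟩
    | add p q _ _ hp hq => exact slopeSet_add hp hq
    | mem q hq =>
      obtain ⟨i, hi, rfl⟩ := hq
      have hUi : 0 ≤ u0 + i * u1 := by positivity
      have hgen : 0 ≤ l0 + i * l1 → a + i * d ∈ slopeSet x y := fun hLi =>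
        hpt _ 1 i (by push_cast; ring) (by push_cast; linarith) (by push_cast; linarith)
      rcases hin with ⟨-, h1⟩ | ⟨h0, hU, h1⟩
      · have hiq : (i : ℚ) ≤ k - 1 := by
          have : (i : ℚ) + 1 ≤ k := by exact_mod_cast hi
          linarith
        exact hgen (by nlinarith)
      · subst h0
        by_cases hlast : i = k - 1
        -- The last generator is written as `a + (a - 1) * d = (1 + d) * a - d`.
        · refine hpt _ (1 + d) (-1) ?_ (by push_cast; linarith) ?_
          · rw [hlast]; push_cast [show 1 ≤ k by omega]; ring
          · push_cast
            have := mul_nonneg hdq.le hl0n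
            linarith
        · have hiq : (i : ℚ) ≤ k - 2 := by
            have : (i : ℚ) + 2 ≤ k := by exact_mod_cast (by omega : i + 2 ≤ k)
            linarith
          exact hgen (by nlinarith)

theorem slopeSet_eq_apSemigroup_iff (hd : 0 < d) (hgcd : Nat.gcd a d = 1)
    (hk : 2 ≤ k) (hka : k ≤ a) (hlam : lam = (a - 2) / (k - 1))
    (hda : d * da = 1 + qa * a) (hda1 : 1 ≤ da) (hdaa : da < a)
    {x y : ℚ} (hx : 0 ≤ x) (hy : y ≤ 1) :
    slopeSet x y = apSemigroup a d k ↔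
      SlopeRange a d k lam da qa x y ∨ SlopeRange a d k lam da qa (1 - y) (1 - x) := by
  have hk1 : ((k - 1 : ℕ) : ℤ) = (k : ℤ) - 1 := by push_cast [show 1 ≤ k by omega]; ring
  have hl1 : ((k : ℤ) - 1) * lam ≤ a - 2 := by
    have h1 : (k - 1) * lam + 2 ≤ a := by
      have := Nat.mul_div_le (a - 2) (k - 1)
      rw [← hlam] at this
      omega
    rw [← hk1]
    have : ((k - 1 : ℕ) : ℤ) * lam + 2 ≤ a := by exact_mod_cast h1
    linarith
  have hl2 : (a : ℤ) - 1 ≤ ((k : ℤ) - 1) * (lam + 1) := by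
    have h1 : a ≤ (k - 1) * (lam + 1) + 1 := by
      have := Nat.lt_mul_div_succ (a - 2) (show 0 < k - 1 by omega)
      rw [← hlam] at this
      omega
    rw [← hk1]
    have : (a : ℤ) ≤ ((k - 1 : ℕ) : ℤ) * (lam + 1) + 1 := by exact_mod_cast h1
    linarith
  have haq : (0 : ℚ) < a := by exact_mod_cast (by omega : 0 < a)
  have hcop : IsCoprime (a : ℤ) d := Nat.isCoprime_iff_coprime.2 hgcd
  have hdaz : (d : ℤ) * da = 1 + qa * a := by exact_mod_cast hda
  -- Determinant `1` fixes `p` modulo `a`; the bounds `0 ≤ x` and `y ≤ 1` keep `p` in `[0, a]`,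
  -- where `da` is the only solution.
  have huniq : ∀ p r : ℤ, 0 ≤ p → p ≤ a → p * d - r * a = 1 → p = da := by
    intro p r h0 h1 h2
    have hdvd : (a : ℤ) ∣ p - da :=
      hcop.dvd_of_dvd_mul_right ⟨r - qa, by linear_combination h2 - hdaz⟩
    have := Int.eq_zero_of_abs_lt_dvd hdvd (by rw [abs_lt]; constructor <;> omega)
    omega
  constructor
  · intro h
    obtain ⟨p, p', ⟨hp1, hp2⟩, hdet⟩ := exists_det_eq_one_or_neg_one hd hgcd hk hka h
    have hp0 : 0 ≤ p := by
      have : (0 : ℚ) ≤ p := le_trans (by positivity) hp1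
      exact_mod_cast this
    have hpa : p ≤ a := by
      have : (p : ℚ) ≤ a := hp2.trans (by nlinarith)
      exact_mod_cast this
    rcases hdet with hdet | hdet
    · left
      have hpq : (p : ℚ) = da := by exact_mod_cast huniq p (p' - p) hp0 hpa hdet
      rw [hpq] at hp1 hp2
      exact slopeRange_of_slopeSet_eq hd hgcd hk hka hl1 hda hp1 hp2 h
    -- Reflection sends `p` to `a - p` and changes the sign of the determinant.
    · right
      have hpq : (a - p : ℚ) = da := by
        exact_mod_cast huniq (a - p) (d - (p' - p)) (by omega) (by omega) (by linarith)
      rw [← slopeSet_reflect] at h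
      exact slopeRange_of_slopeSet_eq hd hgcd hk hka hl1 hda (by linarith) (by linarith) h
  · rintro (h | h)
    · exact slopeSet_eq_of_slopeRange hd hk hka hl1 hl2 hda h
    · rw [← slopeSet_reflect]
      exact slopeSet_eq_of_slopeRange hd hk hka hl1 hl2 hda h

/-! ### From slopes back to bounds on `α` and `β` -/

theorem div_lt_iff_inv_mul_lt {p q α : ℚ} (hq : 0 < q) (hα : 0 < α) :
    p / q < α ↔ α⁻¹ * p < q := by
  rw [div_lt_iff₀ hq, inv_mul_lt_iff₀ hα]

theorem le_div_iff_le_inv_mul {p q α : ℚ} (hq : 0 < q) (hα : 0 < α) :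
    α ≤ p / q ↔ q ≤ α⁻¹ * p := by
  rw [le_div_iff₀ hq, le_inv_mul_iff₀ hα]

theorem div_le_iff_inv_mul_le {p q β : ℚ} (hq : 0 < q) (hβ : 0 < β) :
    p / q ≤ β ↔ β⁻¹ * p ≤ q := by
  rw [div_le_iff₀ hq, inv_mul_le_iff₀ hβ]

/-- For `q = 0` both sides hold because `p > 0`, so the convention `p / 0 = ∞` agrees with clearing
denominators. -/
theorem ltFrac_iff_lt_inv_mul {p q β : ℚ} (hp : 0 < p) (hq : 0 ≤ q) (hβ : 0 < β) :
    LtFrac β p q ↔ q < β⁻¹ * p := by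
  rw [lt_inv_mul_iff₀ hβ, LtFrac]
  rcases hq.eq_or_lt with rfl | hq'
  · simp [hp]
  · rw [lt_div_iff₀ hq']
    simp [hq'.ne']

theorem slopeRange_inv_iff {b : ℕ} (hd : 0 < d) (hk : 2 ≤ k) (hka : k ≤ a)
    (hbq : (b : ℚ) = a + ((k : ℚ) - 1) * d) (hlam0 : k = a → lam = 0) (hda1 : 1 ≤ da)
    {α β : ℚ} (hα : 1 ≤ α) (hβ : 1 ≤ β) :
    SlopeRange a d k lam da qa β⁻¹ α⁻¹ ↔
      ((((lam : ℚ) * a + d * ((a : ℚ) - 1)) / (lam * da + qa * ((a : ℚ) - 1) + 1) < α ∧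
          α ≤ (a : ℚ) / da) ∧
        ((b : ℚ) / (da + ((k : ℚ) - 1) * qa) ≤ β ∧
          LtFrac β (lam * b + d) (lam * (da + ((k : ℚ) - 1) * qa) + qa))) ∨
      (k = a ∧
        (((((d : ℚ) * ((a : ℚ) - 1)) / (qa * ((a : ℚ) - 1) + 1) < α ∧
            α ≤ (b : ℚ) / (((a : ℚ) - 1) * qa + da + 1)) ∧
          (((b : ℚ) - d) / (((a : ℚ) - 2) * qa + da) ≤ β ∧
            LtFrac β d qa)))) := by
  have hα0 : 0 < α := by linarith
  have hβ0 : 0 < β := by linarith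
  have haq : (2 : ℚ) ≤ a := by exact_mod_cast hk.trans hka
  have hkq : (2 : ℚ) ≤ k := by exact_mod_cast hk
  have hdq : (1 : ℚ) ≤ d := by exact_mod_cast hd
  have hda1q : (1 : ℚ) ≤ da := by exact_mod_cast hda1
  have hlq : (0 : ℚ) ≤ lam := by positivity
  have hqa0 : (0 : ℚ) ≤ qa := by positivity
  have hk1 : (0 : ℚ) ≤ (k : ℚ) - 1 := by linarith
  have ha1 : (1 : ℚ) ≤ (a : ℚ) - 1 := by linarith
  have ha20 : (0 : ℚ) ≤ (a : ℚ) - 2 := by linarith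
  have hbpos : 0 < (b : ℚ) := by rw [hbq]; positivity
  rw [SlopeRange, and_or_left, and_or_left]
  refine or_congr ?_ ?_
  · rw [div_lt_iff_inv_mul_lt (by positivity) hα0, le_div_iff_le_inv_mul (by positivity) hα0,
      div_le_iff_inv_mul_le (by positivity) hβ0,
      ltFrac_iff_lt_inv_mul (by positivity) (by positivity) hβ0, hbq]
    tauto
  · constructor
    · rintro ⟨hF, hG, rfl, h1, h2⟩
      refine ⟨rfl, ?_⟩
      rw [div_lt_iff_inv_mul_lt (by positivity) hα0, le_div_iff_le_inv_mul (by positivity) hα0,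
        div_le_iff_inv_mul_le (by positivity) hβ0,
        ltFrac_iff_lt_inv_mul (by positivity) hqa0 hβ0, hbq]
      rw [hlam0 rfl] at hF hG
      push_cast at hF hG
      refine ⟨⟨?_, ?_⟩, ?_, ?_⟩ <;> linarith
    · rintro ⟨rfl, h⟩
      rw [div_lt_iff_inv_mul_lt (by positivity) hα0, le_div_iff_le_inv_mul (by positivity) hα0,
        div_le_iff_inv_mul_le (by positivity) hβ0,
        ltFrac_iff_lt_inv_mul (by positivity) hqa0 hβ0, hbq] at h
      obtain ⟨⟨hF, h1⟩, h2, hG⟩ := h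
      rw [hlam0 rfl]
      refine ⟨?_, ?_, rfl, ?_, ?_⟩ <;> push_cast <;> linarith

theorem slopeRange_reflect_inv_iff {b : ℕ} (hd : 0 < d) (hk : 2 ≤ k) (hka : k ≤ a)
    (hbq : (b : ℚ) = a + ((k : ℚ) - 1) * d) (hlam0 : k = a → lam = 0) (hda1 : 1 ≤ da)
    (hdaa : da < a) (hqa : qa < d)
    {α β : ℚ} (hα : 1 ≤ α) (hβ : 1 ≤ β) :
    SlopeRange a d k lam da qa (1 - α⁻¹) (1 - β⁻¹) ↔
      ((((lam : ℚ) * b + d) / (lam * ((b : ℚ) - da - ((k : ℚ) - 1) * qa) + ((d : ℚ) - qa)) < α ∧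
          α ≤ (b : ℚ) / ((b : ℚ) - da - ((k : ℚ) - 1) * qa)) ∧
        ((a : ℚ) / ((a : ℚ) - da) ≤ β ∧
          LtFrac β (lam * a + d * ((a : ℚ) - 1))
            (lam * ((a : ℚ) - da) + ((d : ℚ) - qa) * ((a : ℚ) - 1) - 1))) ∨
      (k = a ∧
        (((d : ℚ) / ((d : ℚ) - qa) < α ∧
            α ≤ ((b : ℚ) - d) / ((b : ℚ) - d - ((a : ℚ) - 2) * qa - da)) ∧
          ((b : ℚ) / ((b : ℚ) - ((a : ℚ) - 1) * qa - da - 1) ≤ β ∧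
            LtFrac β (d * ((a : ℚ) - 1)) (((d : ℚ) - qa) * ((a : ℚ) - 1) - 1)))) := by
  have hα0 : 0 < α := by linarith
  have hβ0 : 0 < β := by linarith
  have haq : (2 : ℚ) ≤ a := by exact_mod_cast hk.trans hka
  have hkq : (2 : ℚ) ≤ k := by exact_mod_cast hk
  have hdq : (1 : ℚ) ≤ d := by exact_mod_cast hd
  have hda1q : (1 : ℚ) ≤ da := by exact_mod_cast hda1
  have hlq : (0 : ℚ) ≤ lam := by positivity
  have hqa0 : (0 : ℚ) ≤ qa := by positivity
  have hk1 : (0 : ℚ) ≤ (k : ℚ) - 1 := by linarith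
  have ha1 : (1 : ℚ) ≤ (a : ℚ) - 1 := by linarith
  have ha20 : (0 : ℚ) ≤ (a : ℚ) - 2 := by linarith
  have hdaaq : (1 : ℚ) ≤ a - da := by
    have : (da : ℚ) + 1 ≤ a := by exact_mod_cast hdaa
    linarith
  have hqaq : (1 : ℚ) ≤ d - qa := by
    have : (qa : ℚ) + 1 ≤ d := by exact_mod_cast hqa
    linarith
  have hkd : 0 ≤ ((k : ℚ) - 1) * ((d : ℚ) - qa) := mul_nonneg hk1 (by linarith)
  have hbpos : 0 < (b : ℚ) := by rw [hbq]; positivity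
  -- Both factors are at least `1`; the value `0` can occur and is covered by the convention on
  -- fractions.
  have hdqa : 0 ≤ ((d : ℚ) - qa) * ((a : ℚ) - 1) - 1 := by nlinarith
  have hda' : 0 < (d : ℚ) * ((a : ℚ) - 1) := by positivity
  rw [SlopeRange, and_or_left, and_or_left]
  refine or_congr ?_ ?_
  · have hbd : 0 < (b : ℚ) - da - ((k : ℚ) - 1) * qa := by rw [hbq]; linarith
    have hlb : 0 ≤ (lam : ℚ) * (b - da - ((k : ℚ) - 1) * qa) := mul_nonneg hlq hbd.le
    have hlda : 0 ≤ (lam : ℚ) * (a - da) := mul_nonneg hlq (by linarith)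
    rw [div_lt_iff_inv_mul_lt (by linarith) hα0, le_div_iff_le_inv_mul hbd hα0,
      div_le_iff_inv_mul_le (by linarith) hβ0,
      ltFrac_iff_lt_inv_mul (by positivity) (by linarith) hβ0, hbq]
    constructor
    · rintro ⟨hF, hG, h1, h2⟩
      refine ⟨⟨?_, ?_⟩, ?_, ?_⟩ <;> linarith
    · rintro ⟨⟨hG, h2⟩, h1, hF⟩
      refine ⟨?_, ?_, ?_, ?_⟩ <;> linarith
  · have hd2 : 0 ≤ ((a : ℚ) - 2) * ((d : ℚ) - qa) := mul_nonneg ha20 (by linarith)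
    constructor
    · rintro ⟨hF, hG, rfl, h1, h2⟩
      refine ⟨rfl, ?_⟩
      rw [div_lt_iff_inv_mul_lt (by linarith) hα0, le_div_iff_le_inv_mul (by linarith) hα0,
        div_le_iff_inv_mul_le (by linarith) hβ0, ltFrac_iff_lt_inv_mul hda' hdqa hβ0, hbq]
      rw [hlam0 rfl] at hF hG
      push_cast at hF hG
      refine ⟨⟨?_, ?_⟩, ?_, ?_⟩ <;> linarith
    · rintro ⟨rfl, h⟩
      rw [div_lt_iff_inv_mul_lt (by linarith) hα0, le_div_iff_le_inv_mul (by linarith) hα0,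
        div_le_iff_inv_mul_le (by linarith) hβ0, ltFrac_iff_lt_inv_mul hda' hdqa hβ0, hbq] at h
      obtain ⟨⟨hG, h2⟩, h1, hF⟩ := h
      rw [hlam0 rfl]
      refine ⟨?_, ?_, rfl, ?_, ?_⟩ <;> push_cast <;> linarith

end Core

theorem theorem1 (a d k b lam da qa : ℕ)
    (hd : 0 < d) (hgcd : Nat.gcd a d = 1) (hk : 2 ≤ k) (hka : k ≤ a)
    (hb : b = a + (k - 1) * d) (hlam : lam = (a - 2) / (k - 1))
    (hda : d * da = 1 + qa * a) (hda1 : 1 ≤ da) (hdaa : da < a) (hqa : qa < d)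
    (α β : ℚ) (hα : 1 ≤ α) (hβ : 1 ≤ β) :
    assocSemigroup (Set.Icc α β) = apSemigroup a d k ↔
      -- first range
      ((((lam : ℚ) * a + d * ((a : ℚ) - 1)) / (lam * da + qa * ((a : ℚ) - 1) + 1) < α ∧
          α ≤ (a : ℚ) / da) ∧
        ((b : ℚ) / (da + ((k : ℚ) - 1) * qa) ≤ β ∧
          LtFrac β (lam * b + d) (lam * (da + ((k : ℚ) - 1) * qa) + qa))) ∨
      -- second range
      ((((lam : ℚ) * b + d) / (lam * ((b : ℚ) - da - ((k : ℚ) - 1) * qa) + ((d : ℚ) - qa)) < α ∧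
          α ≤ (b : ℚ) / ((b : ℚ) - da - ((k : ℚ) - 1) * qa)) ∧
        ((a : ℚ) / ((a : ℚ) - da) ≤ β ∧
          LtFrac β (lam * a + d * ((a : ℚ) - 1))
            (lam * ((a : ℚ) - da) + ((d : ℚ) - qa) * ((a : ℚ) - 1) - 1))) ∨
      -- two further ranges, only when `k = a`
      (k = a ∧
        (((((d : ℚ) * ((a : ℚ) - 1)) / (qa * ((a : ℚ) - 1) + 1) < α ∧
            α ≤ (b : ℚ) / (((a : ℚ) - 1) * qa + da + 1)) ∧
          (((b : ℚ) - d) / (((a : ℚ) - 2) * qa + da) ≤ β ∧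
            LtFrac β d qa)) ∨
        (((d : ℚ) / ((d : ℚ) - qa) < α ∧
            α ≤ ((b : ℚ) - d) / ((b : ℚ) - d - ((a : ℚ) - 2) * qa - da)) ∧
          ((b : ℚ) / ((b : ℚ) - ((a : ℚ) - 1) * qa - da - 1) ≤ β ∧
            LtFrac β (d * ((a : ℚ) - 1)) (((d : ℚ) - qa) * ((a : ℚ) - 1) - 1))))) := by
  have hα0 : 0 < α := by linarith
  have hβ0 : 0 < β := by linarith
  have hbq : (b : ℚ) = a + ((k : ℚ) - 1) * d := by
    rw [hb]; push_cast [show 1 ≤ k by omega]; ring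
  have hlam0 : k = a → lam = 0 := by
    rintro rfl
    rw [hlam]
    exact Nat.div_eq_of_lt (by omega)
  rw [← SetLike.coe_set_eq, assocSemigroup_Icc_eq_slopeSet hα hβ,
    slopeSet_eq_apSemigroup_iff hd hgcd hk hka hlam hda hda1 hdaa (inv_nonneg.2 hβ0.le)
      (inv_le_one_of_one_le₀ hα),
    slopeRange_inv_iff hd hk hka hbq hlam0 hda1 hα hβ,
    slopeRange_reflect_inv_iff hd hk hka hbq hlam0 hda1 hdaa hqa hα hβ, and_or_left]
  exact or_or_or_comm.trans or_assoc
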